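/- Let $X$ be a complex Banach space with a normalized Schauder basis $(e_k)_{k\ge1}$ and coordinate functionals $(e_k^*)$. Put $E=\mathrm{span}(e_1,e_2)$ and let $P:X\to E$, $Px=\langle e_1^*,x\rangle e_1+\langle e_2^*,x\rangle e_2$. Let $F\subset E$ be a non-empty closed set which is a union of complex lines through $0$, and let $(f_k)_{k\ge1}$ be linear forms on $E$ with $|f_k(x)|\to\infty$ for every $x\in E\setminus F$ and $\liminf_k|f_k(x)|=0$ for every $x\in F$. (1) Let $(m_k)_{k\ge1}$ be positive integers with $m_k\mid m_{k+1}$ for $k\ge1$, $m_k\ge 15\,m_{k-1}$ for $k\ge3$, and $\sum_{k\ge3}\frac{m_{k-2}}{m_{k-1}}\|f_k\|<\infty$. Put $\lambda_1=\lambda_2=1$ and $\lambda_k=e^{i\pi/m_k}$ for $k\ge3$. Then there is a bounded operator $S$ on $X$ with $Se_k=\lambda_ke_k$ for all $k$, the formula $$Rx=Sx+\sum_{k=3}^\infty\frac1{m_{k-1}}f_k(Px)\,e_k$$ defines a bounded operator $R$ on $X$, and $\sigma(R)=\{\lambda_k:k\ge1\}$. (2) Assume moreover that the basis is symmetric (for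 every permutation $\pi$ of the indices, $(e_{\pi(k)})$ is a basis equivalent to $(e_k)$) and that the norm is symmetric: $\|\sum x_ke_{\pi(k)}\|=\|\sum|x_k|e_k\|$ for every permutation $\pi$, and $\|\sum x_ke_k\|\le\|\sum y_ke_k\|$ if $0\le x_k\le y_k$ for all $k$. Let $(a_k)_{k\ge1}$ be a strictly increasing sequence of positive integers with $\sum_k\|f_k\|/a_k<\infty$ and $1+a_k\mid1+a_{k+1}$, and put $m_k=a_1\cdots a_k$, $H_k=2(m_k+m_{k+1})$. Enumerate the vectors $e_n$, $n\ge3$, as $(e_{i,k})_{k\ge1,\,1\le i\le H_k}$, write $y_{i,k}$ for the coordinate of $x$ along $e_{i,k}$, let $\sigma_k$ be the cycle $(1,2,\dots,H_k)$, and put $$Sx=x_1e_1+x_2e_2+\sum_{k=1}^\infty\sum_{i=1}^{H_k}y_{i,k}\,e_{\sigma_k(i),k},\qquad v_k=\epsilon_k\Big(\sum_{i=1}^{m_k}e_{i,k}-\sum_{i=m_k+1}^{2m_k}e_{i,k}\Big),$$ where the real constants $\epsilon_k$ are such that $\|(I+S+\dots+S^{2m_k-1})v_k\|=1$. Then such $S$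 and $\epsilon_k$ exist, the formula $R_{HS}x=Sx+\sum_{k=1}^\infty f_k(Px)v_k$ defines a bounded operator on $X$, and for every such $R_{HS}$ one has $\partial\mathbb D\subset\sigma(R_{HS})\subset\overline{\mathbb D}$. -/

import Mathlib

noncomputable section

namespace OrbitSpectra

open Filter Topology

/- Indices: all sequences below are indexed by `ℕ`, starting at `0`; the entry with index `k`
stands for the entry with index `k + 1` of the sequences `(e_k)`, `(f_k)`, `(m_k)`, `(lambda_k)`,
`(a_k)`, `(H_k)`, which start at `1` in the usual notation. -/

variable {X : Type*} [NormedAddCommGroup X] [NormedSpace ℂ X]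

/-- The plane spanned by the first two vectors of the basis, with the norm of `X`. -/
abbrev plane (b : SchauderBasis ℂ X) : Submodule ℂ X := Submodule.span ℂ {b 0, b 1}

/-- The projection `P x = ⟨e₁*, x⟩ e₁ + ⟨e₂*, x⟩ e₂` of `X` onto the plane of `e₁, e₂`. -/
def proj (b : SchauderBasis ℂ X) : X →L[ℂ] plane b :=
  (b.coord 0).smulRight (⟨b 0, Submodule.subset_span (by simp)⟩ : plane b) +
    (b.coord 1).smulRight (⟨b 1, Submodule.subset_span (by simp)⟩ : plane b)

/-- `F` is a non-empty closed set which is a union of complex lines through `0`. -/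
structure IsClosedUnionOfLines {E : Type*} [NormedAddCommGroup E] [NormedSpace ℂ E]
    (F : Set E) : Prop where
  nonempty : F.Nonempty
  isClosed : IsClosed F
  lines : ∃ L : Set (Submodule ℂ E),
    (∀ l ∈ L, Module.finrank ℂ l = 1) ∧ F = ⋃ l ∈ L, (l : Set E)

/-- The linear forms `f n` separate `F` from its complement asymptotically: `|f n x| → ∞` off `F`
and `liminf |f n x| = 0` on `F` (the lower limit is taken in `[0, ∞]`). -/
structure IsSeparating {E : Type*} [NormedAddCommGroup E] [NormedSpace ℂ E]
    (F : Set E) (f : ℕ → StrongDual ℂ E) : Prop where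
  off : ∀ x, x ∉ F → Tendsto (fun n => ‖f n x‖) atTop atTop
  on : ∀ x, x ∈ F → liminf (fun n => ‖f n x‖ₑ) atTop = 0

/-! ### The operator built from a diagonal operator -/

/-- The conditions on the integers `m_k`: positivity, `m_k ∣ m_{k+1}`,
`∑_{k ≥ 3} (m_{k-2} / m_{k-1}) ‖f_k‖ < ∞` and `m_k ≥ 15 m_{k-1}` for `k ≥ 3`. -/
structure IsFastSequence {E : Type*} [NormedAddCommGroup E] [NormedSpace ℂ E]
    (f : ℕ → StrongDual ℂ E) (m : ℕ → ℕ) : Prop where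
  pos : ∀ k, 0 < m k
  dvd : ∀ k, m k ∣ m (k + 1)
  summable : Summable fun k => (m k : ℝ) / (m (k + 1) : ℝ) * ‖f (k + 2)‖
  growth : ∀ k, 15 * m (k + 1) ≤ m (k + 2)

/-- `lambda_1 = lambda_2 = 1` and `lambda_k = exp (i π / m_k)` for `k ≥ 3`. -/
def lam (m : ℕ → ℕ) (k : ℕ) : ℂ :=
  if k < 2 then 1 else Complex.exp (Complex.I * (Real.pi : ℂ) / (m k : ℂ))

/-- `R x = S x + ∑_{k ≥ 3} (1 / m_{k-1}) f_k(P x) e_k` for all `x`, where `S` is the bounded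
operator with `S e_k = lambda_k e_k` for all `k`. (At most one `S`, hence at most one `R`,
satisfies this, because the span of the `e_k` is dense.) -/
def IsDiagonalTypeOperator (b : SchauderBasis ℂ X) (f : ℕ → StrongDual ℂ (plane b)) (m : ℕ → ℕ)
    (R : X →L[ℂ] X) : Prop :=
  ∃ S : X →L[ℂ] X, (∀ k, S (b k) = lam m k • b k) ∧
    ∀ x, HasSum (fun k => ((1 / (m (k + 1) : ℂ)) * f (k + 2) (proj b x)) • b (k + 2)) (R x - S x)

/-! ### The operator of Hájek–Smith type -/

/-- For every permutation `π` of the integers, `(e_{π k})` is a Schauder basis which is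
equivalent to `(e_k)`: the series `∑ c_k e_k` and `∑ c_k e_{π k}` converge for the same
scalar sequences `c`. -/
def IsSymmetricBasis (b : SchauderBasis ℂ X) : Prop :=
  ∀ π : Equiv.Perm ℕ, (∃ b' : SchauderBasis ℂ X, ∀ k, b' k = b (π k)) ∧
    ∀ c : ℕ → ℂ, Summable (fun k => c k • b k) (SummationFilter.conditional ℕ) ↔
      Summable (fun k => c k • b (π k)) (SummationFilter.conditional ℕ)

/-- The norm of `X` is symmetric for the basis: `‖∑ x_k e_{π k}‖ = ‖∑ |x_k| e_k‖`, and
`‖∑ x_k e_k‖ ≤ ‖∑ y_k e_k‖` whenever `0 ≤ x_k ≤ y_k` for all `k`, for convergent series. -/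
structure IsSymmetricNorm (b : SchauderBasis ℂ X) : Prop where
  norm_perm : ∀ (π : Equiv.Perm ℕ) (x : ℕ → ℂ) (u v : X),
    HasSum (fun k => x k • b (π k)) u (SummationFilter.conditional ℕ) →
    HasSum (fun k => ((‖x k‖ : ℝ) : ℂ) • b k) v (SummationFilter.conditional ℕ) → ‖u‖ = ‖v‖
  norm_mono : ∀ (x y : ℕ → ℝ) (u v : X), (∀ k, 0 ≤ x k ∧ x k ≤ y k) →
    HasSum (fun k => (x k : ℂ) • b k) u (SummationFilter.conditional ℕ) →
    HasSum (fun k => (y k : ℂ) • b k) v (SummationFilter.conditional ℕ) → ‖u‖ ≤ ‖v‖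

/-- The conditions on the integers `a_k`: positive, strictly increasing,
`∑ ‖f_k‖ / a_k < ∞` and `1 + a_k ∣ 1 + a_{k+1}`. -/
structure IsHSSequence {E : Type*} [NormedAddCommGroup E] [NormedSpace ℂ E]
    (f : ℕ → StrongDual ℂ E) (a : ℕ → ℕ) : Prop where
  pos : ∀ k, 0 < a k
  strictMono : StrictMono a
  summable : Summable fun k => ‖f k‖ / (a k : ℝ)
  dvd : ∀ k, 1 + a k ∣ 1 + a (k + 1)

/-- `m_k = a_1 ⋯ a_k`. -/
def hsM (a : ℕ → ℕ) (k : ℕ) : ℕ := ∏ i ∈ Finset.range (k + 1), a i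

/-- The block lengths `H_k = 2 (m_k + m_{k+1})`. -/
def hsH (a : ℕ → ℕ) (k : ℕ) : ℕ := 2 * (hsM a k + hsM a (k + 1))

/-- `e_{i,k}`: the basis vectors `e_3, e_4, …` are enumerated in blocks of lengths `H_1, H_2, …`
by `φ`. -/
def blockVec (b : SchauderBasis ℂ X) (a : ℕ → ℕ) (φ : (Σ k, Fin (hsH a k)) ≃ ℕ)
    (k : ℕ) (i : Fin (hsH a k)) : X :=
  b (φ ⟨k, i⟩ + 2)

/-- `y_{i,k}`: the coordinate along `e_{i,k}`. -/
def blockCoord (b : SchauderBasis ℂ X) (a : ℕ → ℕ) (φ : (Σ k, Fin (hsH a k)) ≃ ℕ)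
    (k : ℕ) (i : Fin (hsH a k)) : StrongDual ℂ X :=
  b.coord (φ ⟨k, i⟩ + 2)

/-- `S x = x_1 e_1 + x_2 e_2 + ∑_k ∑_i y_{i,k} e_{σ_k(i),k}` for all `x`, where `σ_k` is the
cycle `(1, 2, …, H_k)`. -/
def IsCycleOperator (b : SchauderBasis ℂ X) (a : ℕ → ℕ) (φ : (Σ k, Fin (hsH a k)) ≃ ℕ)
    (S : X →L[ℂ] X) : Prop :=
  ∀ x, HasSum
    (fun k => ∑ i, blockCoord b a φ k i x • blockVec b a φ k (finRotate (hsH a k) i))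
    (S x - (b.coord 0 x • b 0 + b.coord 1 x • b 1))

/-- `∑_{i=1}^{m_k} e_{i,k} - ∑_{i=m_k+1}^{2m_k} e_{i,k}`; note that `2 m_k ≤ H_k`. -/
def bump (b : SchauderBasis ℂ X) (a : ℕ → ℕ) (φ : (Σ k, Fin (hsH a k)) ≃ ℕ) (k : ℕ) : X :=
  (∑ i with i.val < hsM a k, blockVec b a φ k i) -
    ∑ i with hsM a k ≤ i.val ∧ i.val < 2 * hsM a k, blockVec b a φ k i

/-- `R x = S x + ∑_k f_k(P x) v_k` for all `x`, with `S` the cycle operator and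
`v_k = ε_k (∑_{i ≤ m_k} e_{i,k} - ∑_{m_k < i ≤ 2m_k} e_{i,k})`, where the constants `ε_k` are such
that `‖(I + S + ⋯ + S^{2m_k - 1}) v_k‖ = 1`. -/
def IsHSOperator (b : SchauderBasis ℂ X) (f : ℕ → StrongDual ℂ (plane b)) (a : ℕ → ℕ)
    (φ : (Σ k, Fin (hsH a k)) ≃ ℕ) (R : X →L[ℂ] X) : Prop :=
  ∃ (S : X →L[ℂ] X) (ε : ℕ → ℝ), IsCycleOperator b a φ S ∧
    (∀ k, ‖∑ l ∈ Finset.range (2 * hsM a k), (S ^ l) ((ε k : ℂ) • bump b a φ k)‖ = 1) ∧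
    ∀ x, HasSum (fun k => f k (proj b x) • ((ε k : ℂ) • bump b a φ k)) (R x - S x)

end OrbitSpectra

end

/-!
Both operators have the form `R = S + T`, where `S` preserves the projection `P` onto the plane of
`e₁, e₂`, and `T` factors through `P` and satisfies `P T = 0`. Such a `T` is a square-zero
perturbation in a strong sense: `T (μ - S)⁻¹ T = 0` whenever `μ` is not in the spectrum of `S`.
Hence `σ(R) ⊆ σ(S)` (`isUnit_algebraMap_sub_add`, `spectrum_subset_of_hasSum_sub`), while every
eigenvector of `S` in the kernel of `P` is an eigenvector of `R`.

For the diagonal operator, `λ_k → 1` geometrically, so `(λ_k)` has bounded variation and the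
diagonal operator `S` is bounded (`exists_diagonal`). Its resolvent is diagonal with coefficients
of bounded variation, so `σ(S)` lies in the closure of `{λ_k}` (`spectrum_diagonal_subset`), which
is `{λ_k}` as `λ_1 = 1` is the limit. Conversely `λ_k`, `k ≥ 3`, is an eigenvalue of `R`, and `1` is
a limit of eigenvalues.

For the cycle operator, a symmetric norm makes the basis unconditional with contractive coordinate
projections, and every permutation of the basis extends to an isometry of `X`
(`IsSymmetricNorm.permIsometry`). The operator `S` is one of these, so `σ(S)` is contained in the
closed unit disc. On the block of length `H_k` it has every `H_k`-th root of unity as an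
eigenvalue, and these roots are dense in the circle as `H_k → ∞`
(`sphere_subset_of_rootsOfUnity`). The series for `R - S` converges in operator norm because
`‖v_k‖ ≤ 4 / a_k` (`norm_sum_pow_bump`), by an estimate for sums of shifts
(`mul_norm_sum_le_norm_sum_pow_apply`).
-/

noncomputable section

namespace OrbitSpectra

open Filter Topology

variable {X : Type*} [NormedAddCommGroup X] [NormedSpace ℂ X]

theorem _root_.SchauderBasis.ext_clm {Y : Type*} [NormedAddCommGroup Y] [NormedSpace ℂ Y]
    (b : SchauderBasis ℂ X) {A B : X →L[ℂ] Y} (h : ∀ k, A (b k) = B (b k)) : A = B := by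
  ext x
  have hx := b.expansion x
  have hA : HasSum (fun i => b.coord i x • A (b i)) (A x) (SummationFilter.conditional ℕ) := by
    simpa [Function.comp_def] using hx.map A A.continuous
  have hB : HasSum (fun i => b.coord i x • A (b i)) (B x) (SummationFilter.conditional ℕ) := by
    simpa [Function.comp_def, h] using hx.map B B.continuous
  exact hA.unique hB

/-! ### Perturbation by an operator of square zero -/

/-- If `S` preserves `Q`, and `T` factors through `Q` and has range in the kernel of `Q`, then
adding `T` to `S` creates no spectrum: with `V = (μ - S)⁻¹` one has `Q V T = 0`, hence `T V T = 0`, and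
`μ - (S + T) = (μ - S) (1 - V T)` is a unit because `V T` has square zero. -/
theorem isUnit_algebraMap_sub_add {E : Type*} [NormedAddCommGroup E] [NormedSpace ℂ E]
    (Q : X →L[ℂ] E) {S T : X →L[ℂ] X} (hS : ∀ x, Q (S x) = Q x) (hQT : ∀ x, Q (T x) = 0)
    (hT : ∀ x, Q x = 0 → T x = 0) {μ : ℂ} (hμ : IsUnit (algebraMap ℂ (X →L[ℂ] X) μ - S)) :
    IsUnit (algebraMap ℂ (X →L[ℂ] X) μ - (S + T)) := by
  obtain ⟨A, hA⟩ := hμ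
  have hQA : ∀ y, Q ((A : X →L[ℂ] X) y) = (μ - 1) • Q y := fun y => by
    rw [hA]; simp [Algebra.algebraMap_eq_smul_one, hS, sub_smul]
  have hAV : ∀ y, (A : X →L[ℂ] X) ((↑A⁻¹ : X →L[ℂ] X) y) = y := fun y => by
    rw [← mul_apply_eq_comp, A.mul_inv]; rfl
  have hTVT : T * (↑A⁻¹ : X →L[ℂ] X) * T = 0 := by
    ext x
    apply hT
    have h1 : (μ - 1) • Q ((↑A⁻¹ : X →L[ℂ] X) (T x)) = 0 := by rw [← hQA, hAV, hQT]
    rcases smul_eq_zero.1 h1 with h | h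
    · -- `μ = 1` forces `Q = 0`, because `Q ∘ A = 0` and `A` is onto
      have h2 := hQA ((↑A⁻¹ : X →L[ℂ] X) ((↑A⁻¹ : X →L[ℂ] X) (T x)))
      rwa [hAV, h, zero_smul] at h2
    · exact h
  have hnil : IsNilpotent (-((↑A⁻¹ : X →L[ℂ] X) * T)) :=
    ⟨2, by rw [neg_sq, sq, mul_assoc, ← mul_assoc T, hTVT, mul_zero]⟩
  have : algebraMap ℂ (X →L[ℂ] X) μ - (S + T)
      = (A : X →L[ℂ] X) * (1 + -((↑A⁻¹ : X →L[ℂ] X) * T)) := by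
    rw [mul_add, mul_neg, ← mul_assoc, A.mul_inv, mul_one, one_mul, hA]; abel
  rw [this]
  exact A.isUnit.mul hnil.isUnit_one_add

theorem mem_spectrum_of_eigenvector {R : X →L[ℂ] X} {μ : ℂ} {x : X} (hx : x ≠ 0)
    (h : R x = μ • x) : μ ∈ spectrum ℂ R := by
  rw [spectrum.mem_iff]
  rintro ⟨A, hA⟩
  apply hx
  have : (A : X →L[ℂ] X) x = 0 := by
    rw [hA]; simp [Algebra.algebraMap_eq_smul_one, h]
  calc x = ((↑A⁻¹ : X →L[ℂ] X) * A) x := by rw [A.inv_mul]; rfl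
    _ = 0 := by rw [mul_apply_eq_comp, this, map_zero]

theorem exists_clm_hasSum_smul [CompleteSpace X] {E : Type*} [NormedAddCommGroup E]
    [NormedSpace ℂ E] (Q : X →L[ℂ] E) (g : ℕ → StrongDual ℂ E) (v : ℕ → X)
    (h : Summable fun k => ‖g k‖ * ‖v k‖) :
    ∃ T : X →L[ℂ] X, ∀ x, HasSum (fun k => g k (Q x) • v k) (T x) := by
  have hs : Summable fun k => ((g k).comp Q).smulRight (v k) := by
    refine Summable.of_norm_bounded (h.mul_left ‖Q‖) fun k => ?_
    rw [ContinuousLinearMap.norm_smulRight_apply]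
    calc ‖(g k).comp Q‖ * ‖v k‖ ≤ ‖g k‖ * ‖Q‖ * ‖v k‖ := by
          gcongr; exact ContinuousLinearMap.opNorm_comp_le _ _
      _ = _ := by ring
  refine ⟨∑' k, ((g k).comp Q).smulRight (v k), fun x => ?_⟩
  simpa [Function.comp_def] using hs.hasSum.map (ContinuousLinearMap.apply ℂ X x)
    (ContinuousLinearMap.apply ℂ X x).continuous

/-! ### The projection onto the plane -/

theorem coord_basis (b : SchauderBasis ℂ X) (i j : ℕ) :
    b.coord i (b j) = if i = j then 1 else 0 := by
  simp [b.ortho, Pi.single_apply]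

theorem proj_congr (b : SchauderBasis ℂ X) {x y : X} (h0 : b.coord 0 x = b.coord 0 y)
    (h1 : b.coord 1 x = b.coord 1 y) : proj b x = proj b y := by
  simp [proj, h0, h1]

theorem proj_basis (b : SchauderBasis ℂ X) (k : ℕ) : proj b (b (k + 2)) = 0 := by
  simp [proj, coord_basis]

theorem proj_hasSum_eq_zero (b : SchauderBasis ℂ X) {c : ℕ → ℂ} {v : ℕ → X} {y : X}
    (hv : ∀ k, proj b (v k) = 0) (h : HasSum (fun k => c k • v k) y) : proj b y = 0 := by
  have := h.map (proj b) (proj b).continuous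
  simp only [Function.comp_def, map_smul, hv, smul_zero] at this
  exact this.unique hasSum_zero

/-- The square-zero perturbation principle in the form common to both operators: here
`T = R - S` is the sum of the rank one operators `g k (proj b ·) • v k`. -/
theorem spectrum_subset_of_hasSum_sub (b : SchauderBasis ℂ X) {S R : X →L[ℂ] X}
    {g : ℕ → StrongDual ℂ (plane b)} {v : ℕ → X}
    (hS : ∀ x, proj b (S x) = proj b x) (hv : ∀ k, proj b (v k) = 0)
    (hR : ∀ x, HasSum (fun k => g k (proj b x) • v k) (R x - S x)) :
    spectrum ℂ R ⊆ spectrum ℂ S := by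
  intro μ hμ
  rw [spectrum.mem_iff] at hμ ⊢
  contrapose! hμ
  have := isUnit_algebraMap_sub_add (proj b) (S := S) (T := R - S) hS
    (fun x => proj_hasSum_eq_zero b hv (hR x))
    (fun x hx => by
      have h := hR x
      simp only [hx, map_zero, zero_smul] at h
      exact h.unique hasSum_zero) hμ
  simpa using this

theorem apply_eq_of_proj_eq_zero (b : SchauderBasis ℂ X) {S R : X →L[ℂ] X}
    {g : ℕ → StrongDual ℂ (plane b)} {v : ℕ → X}
    (hR : ∀ x, HasSum (fun k => g k (proj b x) • v k) (R x - S x)) {x : X}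
    (hx : proj b x = 0) : R x = S x := by
  have h := hR x
  simp only [hx, map_zero, zero_smul] at h
  exact sub_eq_zero.1 (h.unique hasSum_zero)

/-! ### Diagonal operators -/

/-- A sequence of bounded variation defines a bounded diagonal operator. Summation by parts suggests
`D = d 0 + ∑ (d (i + 1) - d i) (1 - P_{i + 1})`, with `P_i` the (uniformly bounded) basis
projections; this series converges in operator norm. -/
theorem exists_diagonal [CompleteSpace X] (b : SchauderBasis ℂ X) (d : ℕ → ℂ)
    (hd : Summable fun k => ‖d (k + 1) - d k‖) :
    ∃ D : X →L[ℂ] X, ∀ k, D (b k) = d k • b k := by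
  obtain ⟨C, hC⟩ := SchauderBasis.exists_norm_proj_le b
  have hs : Summable fun i => (d (i + 1) - d i) •
      (ContinuousLinearMap.id ℂ X - SchauderBasis.proj b (i + 1)) := by
    refine Summable.of_norm_bounded (hd.mul_right (1 + C)) fun i => ?_
    rw [norm_smul]
    gcongr
    exact (norm_sub_le _ _).trans (add_le_add ContinuousLinearMap.norm_id_le (hC _))
  refine ⟨d 0 • ContinuousLinearMap.id ℂ X + ∑' i, (d (i + 1) - d i) •
      (ContinuousLinearMap.id ℂ X - SchauderBasis.proj b (i + 1)), fun k => ?_⟩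
  have h1 := hs.hasSum.map (ContinuousLinearMap.apply ℂ X (b k))
    (ContinuousLinearMap.apply ℂ X (b k)).continuous
  -- On `b k` only the terms with `i < k` survive, and they telescope.
  have h2 : HasSum (fun i => (d (i + 1) - d i) • (b k - SchauderBasis.proj b (i + 1) (b k)))
      (∑ i ∈ Finset.range k, (d (i + 1) - d i) • b k) := by
    convert hasSum_sum_of_ne_finset_zero (s := Finset.range k)
      (L := SummationFilter.unconditional ℕ) _ using 1
    · refine Finset.sum_congr rfl fun i hi => ?_
      rw [SchauderBasis.proj_apply_basis_mem, if_neg, sub_zero]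
      simpa [Nat.succ_le_iff] using hi
    · intro i hi
      rw [SchauderBasis.proj_apply_basis_mem, if_pos, sub_self, smul_zero]
      simp at hi; omega
  have h3 := h2.unique (by simpa [Function.comp_def] using! h1)
  rw [add_apply, ← ContinuousLinearMap.apply_apply (b k) (∑' _, _)]
  simp only [ContinuousLinearMap.apply_apply] at h3 ⊢
  rw [← h3, ← Finset.sum_smul, Finset.sum_range_sub, smul_apply,
    ContinuousLinearMap.id_apply, ← add_smul, add_sub_cancel]

/-- Off the closure of `range d`, the sequence `(μ - d k)⁻¹` again has bounded variation, and so
defines the resolvent of the diagonal operator. -/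
theorem spectrum_diagonal_subset [CompleteSpace X] (b : SchauderBasis ℂ X) {d : ℕ → ℂ}
    (hd : Summable fun k => ‖d (k + 1) - d k‖) {S : X →L[ℂ] X}
    (hS : ∀ k, S (b k) = d k • b k) : spectrum ℂ S ⊆ closure (Set.range d) := by
  intro μ hμ
  by_contra hcl
  obtain ⟨δ, hδ, hball⟩ : ∃ δ > 0, ∀ k, δ ≤ ‖μ - d k‖ := by
    rw [Metric.mem_closure_iff] at hcl
    push Not at hcl
    obtain ⟨δ, hδ, h⟩ := hcl
    exact ⟨δ, hδ, fun k => by simpa [dist_eq_norm] using h _ ⟨k, rfl⟩⟩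
  have hne : ∀ k, μ - d k ≠ 0 := fun k => norm_pos_iff.1 (hδ.trans_le (hball k))
  obtain ⟨D, hD⟩ := exists_diagonal b (fun k => (μ - d k)⁻¹) (by
    refine Summable.of_nonneg_of_le (fun _ => norm_nonneg _) (fun k => ?_)
      (hd.mul_left (δ * δ)⁻¹)
    have : (μ - d (k + 1))⁻¹ - (μ - d k)⁻¹
        = ((μ - d (k + 1)) * (μ - d k))⁻¹ * (d (k + 1) - d k) := by
      field_simp [hne k, hne (k + 1)]
      ring
    rw [this, norm_mul, norm_inv, norm_mul]
    gcongr
    · exact hball _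
    · exact hball _)
  rw [spectrum.mem_iff] at hμ
  apply hμ
  refine isUnit_iff_exists.2 ⟨D, ?_, ?_⟩ <;> refine b.ext_clm fun k => ?_ <;>
    simp [Algebra.algebraMap_eq_smul_one, hS, hD, smul_smul, ← sub_smul, hne k]

/-! ### Eigenvalues accumulating at `1` -/

theorem IsFastSequence.pow_le {E : Type*} [NormedAddCommGroup E] [NormedSpace ℂ E]
    {f : ℕ → StrongDual ℂ E} {m : ℕ → ℕ} (hm : IsFastSequence f m) (k : ℕ) :
    15 ^ k ≤ m (k + 1) := by
  induction k with
  | zero => simpa using Nat.succ_le_of_lt (hm.pos 1)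
  | succ k ih =>
    have : 15 * m (k + 1) ≤ m (k + 1 + 1) := hm.growth k
    rw [pow_succ]; omega

theorem IsFastSequence.norm_lam_sub_one_le {E : Type*} [NormedAddCommGroup E] [NormedSpace ℂ E]
    {f : ℕ → StrongDual ℂ E} {m : ℕ → ℕ} (hm : IsFastSequence f m) (k : ℕ) :
    ‖lam m (k + 1) - 1‖ ≤ Real.pi * (1 / 15) ^ k := by
  unfold lam
  split_ifs with h
  · simp; positivity
  have hp : (0 : ℝ) < m (k + 1) := by exact_mod_cast hm.pos _
  have h1 : Complex.I * (Real.pi : ℂ) / (m (k + 1) : ℂ)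
      = Complex.I * ((Real.pi / (m (k + 1) : ℝ) : ℝ) : ℂ) := by push_cast; ring
  rw [h1]
  refine (Real.norm_exp_I_mul_ofReal_sub_one_le (x := _)).trans ?_
  rw [Real.norm_of_nonneg (by positivity), div_eq_mul_inv, one_div, inv_pow]
  gcongr
  exact_mod_cast hm.pow_le k

theorem IsFastSequence.tendsto_lam {E : Type*} [NormedAddCommGroup E] [NormedSpace ℂ E]
    {f : ℕ → StrongDual ℂ E} {m : ℕ → ℕ} (hm : IsFastSequence f m) :
    Tendsto (lam m) atTop (𝓝 1) := by
  rw [← tendsto_add_atTop_iff_nat 1, tendsto_iff_norm_sub_tendsto_zero]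
  refine squeeze_zero (fun _ => norm_nonneg _) hm.norm_lam_sub_one_le ?_
  simpa using (tendsto_pow_atTop_nhds_zero_of_lt_one (r := (1 / 15 : ℝ)) (by norm_num)
    (by norm_num)).const_mul Real.pi

theorem IsFastSequence.summable_lam {E : Type*} [NormedAddCommGroup E] [NormedSpace ℂ E]
    {f : ℕ → StrongDual ℂ E} {m : ℕ → ℕ} (hm : IsFastSequence f m) :
    Summable fun k => ‖lam m (k + 1) - lam m k‖ := by
  rw [← summable_nat_add_iff 1]
  have hg : Summable fun k : ℕ => (1 / 15 : ℝ) ^ k :=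
    summable_geometric_of_lt_one (by norm_num) (by norm_num)
  refine Summable.of_nonneg_of_le (fun _ => norm_nonneg _) (fun k => ?_)
    (((hg.comp_injective (add_left_injective 1)).mul_left Real.pi).add (hg.mul_left Real.pi))
  have := norm_sub_le (lam m (k + 1 + 1) - 1) (lam m (k + 1) - 1)
  rw [sub_sub_sub_cancel_right] at this
  exact this.trans (add_le_add (hm.norm_lam_sub_one_le _) (hm.norm_lam_sub_one_le _))

theorem IsFastSequence.closure_range_lam {E : Type*} [NormedAddCommGroup E] [NormedSpace ℂ E]
    {f : ℕ → StrongDual ℂ E} {m : ℕ → ℕ} (hm : IsFastSequence f m) :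
    closure (Set.range (lam m)) = Set.range (lam m) := by
  refine IsClosed.closure_eq ?_
  -- The limit `1` of the sequence is attained, at the index `0`.
  have h := hm.tendsto_lam.isCompact_insert_range.isClosed
  rwa [Set.insert_eq_of_mem (Set.mem_range.2 ⟨0, by simp [lam]⟩)] at h

theorem coord_diagonal (b : SchauderBasis ℂ X) {d : ℕ → ℂ} {S : X →L[ℂ] X}
    (hS : ∀ k, S (b k) = d k • b k) (i : ℕ) (x : X) :
    b.coord i (S x) = d i * b.coord i x := by
  have : (b.coord i).comp S = d i • b.coord i := b.ext_clm fun k => by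
    by_cases h : i = k
    · subst h; simp [hS]
    · simp [hS, coord_basis, h]
  simpa using congrArg (fun g => g x) this

theorem exists_isDiagonalTypeOperator [CompleteSpace X] (b : SchauderBasis ℂ X)
    (hb : ∀ k, ‖b k‖ = 1) {f : ℕ → StrongDual ℂ (plane b)} {m : ℕ → ℕ}
    (hm : IsFastSequence f m) : ∃ R : X →L[ℂ] X, IsDiagonalTypeOperator b f m R := by
  obtain ⟨S, hS⟩ := exists_diagonal b (lam m) hm.summable_lam
  obtain ⟨T, hT⟩ := exists_clm_hasSum_smul (proj b)
    (fun k => (1 / (m (k + 1) : ℂ)) • f (k + 2)) (fun k => b (k + 2)) (by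
      refine Summable.of_nonneg_of_le (fun _ => by positivity) (fun k => ?_) hm.summable
      rw [hb, mul_one, norm_smul]
      gcongr
      have : (1 : ℝ) ≤ m k := by exact_mod_cast hm.pos k
      simpa [div_eq_mul_inv] using le_mul_of_one_le_left (by positivity) this)
  exact ⟨S + T, S, hS, fun x => by simpa using hT x⟩

theorem IsDiagonalTypeOperator.spectrum_eq [CompleteSpace X] {b : SchauderBasis ℂ X}
    (hb : ∀ k, ‖b k‖ = 1) {f : ℕ → StrongDual ℂ (plane b)} {m : ℕ → ℕ}
    (hm : IsFastSequence f m) {R : X →L[ℂ] X} (hR : IsDiagonalTypeOperator b f m R) :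
    spectrum ℂ R = Set.range (lam m) := by
  obtain ⟨S, hS, hR⟩ := hR
  have hR' : ∀ x, HasSum (fun k => ((1 / (m (k + 1) : ℂ)) • f (k + 2)) (proj b x) • b (k + 2))
      (R x - S x) := fun x => by simpa using hR x
  apply subset_antisymm
  · rw [← hm.closure_range_lam]
    exact (spectrum_subset_of_hasSum_sub b
      (fun x => proj_congr b (by simp [coord_diagonal b hS, lam])
        (by simp [coord_diagonal b hS, lam])) (proj_basis b) hR').trans
      (spectrum_diagonal_subset b hm.summable_lam hS)
  · have h2 : ∀ k, lam m (k + 2) ∈ spectrum ℂ R := fun k =>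
      mem_spectrum_of_eigenvector (x := b (k + 2)) (norm_pos_iff.1 (by rw [hb]; norm_num))
        (by rw [apply_eq_of_proj_eq_zero b hR' (proj_basis b k), hS])
    -- `b 0` and `b 1` need not be eigenvectors, but `1` is a limit of eigenvalues.
    have h1 : (1 : ℂ) ∈ spectrum ℂ R :=
      (spectrum.isClosed R).mem_of_tendsto
        ((tendsto_add_atTop_iff_nat 2).2 hm.tendsto_lam) (Eventually.of_forall h2)
    rintro _ ⟨k, rfl⟩
    rcases k with _ | _ | k
    · simpa [lam] using h1
    · simpa [lam] using h1
    · exact h2 k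

/-! ### Symmetric norms -/

namespace IsSymmetricNorm

variable {b : SchauderBasis ℂ X}

theorem hasSum_indicator (s : Finset ℕ) (c : ℕ → ℂ) (e : ℕ → X) :
    HasSum (fun k => (if k ∈ s then c k else 0) • e k) (∑ k ∈ s, c k • e k)
      (SummationFilter.conditional ℕ) := by
  have := hasSum_sum_of_ne_finset_zero (s := s) (L := SummationFilter.conditional ℕ)
    (f := fun k => (if k ∈ s then c k else 0) • e k) (fun k hk => by simp [hk])
  rwa [Finset.sum_congr rfl (g := fun k => c k • e k) (fun k hk => by simp [hk])] at this

/-- Taking `π = 1` as well eliminates the absolute values from `norm_perm`. -/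
theorem norm_sum_perm (h : IsSymmetricNorm b) (π : Equiv.Perm ℕ) (s : Finset ℕ) (c : ℕ → ℂ) :
    ‖∑ k ∈ s, c k • b (π k)‖ = ‖∑ k ∈ s, c k • b k‖ := by
  have key : ∀ π : Equiv.Perm ℕ, ‖∑ k ∈ s, c k • b (π k)‖
      = ‖∑ k ∈ s, ((‖c k‖ : ℝ) : ℂ) • b k‖ := fun π =>
    h.norm_perm π (fun k => if k ∈ s then c k else 0) _ _
      (hasSum_indicator s c fun k => b (π k)) (by
        convert hasSum_indicator s (fun k => ((‖c k‖ : ℝ) : ℂ)) b using 3 with k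
        split_ifs <;> simp)
  rw [key π, ← key 1]; rfl

theorem norm_sum_mono (h : IsSymmetricNorm b) {s t : Finset ℕ} (hst : s ⊆ t) (c : ℕ → ℂ) :
    ‖∑ k ∈ s, c k • b k‖ ≤ ‖∑ k ∈ t, c k • b k‖ := by
  have key : ∀ s : Finset ℕ, ‖∑ k ∈ s, c k • b k‖
      = ‖∑ k ∈ s, ((‖c k‖ : ℝ) : ℂ) • b k‖ := fun s =>
    h.norm_perm 1 (fun k => if k ∈ s then c k else 0) _ _
      (hasSum_indicator s c b) (by
        convert hasSum_indicator s (fun k => ((‖c k‖ : ℝ) : ℂ)) b using 3 with k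
        split_ifs <;> simp)
  rw [key s, key t]
  refine h.norm_mono (fun k => if k ∈ s then ‖c k‖ else 0) (fun k => if k ∈ t then ‖c k‖ else 0)
    _ _ (fun k => ?_) ?_ ?_
  · by_cases hs : k ∈ s
    · simp [hs, hst hs]
    · simp only [hs, if_false, le_refl, true_and]
      split_ifs <;> simp
  · convert hasSum_indicator s (fun k => ((‖c k‖ : ℝ) : ℂ)) b using 3 with k
    split_ifs <;> simp
  · convert hasSum_indicator t (fun k => ((‖c k‖ : ℝ) : ℂ)) b using 3 with k
    split_ifs <;> simp

theorem norm_proj_apply_le (h : IsSymmetricNorm b) (s : Finset ℕ) (x : X) :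
    ‖GeneralSchauderBasis.proj b s x‖ ≤ ‖x‖ := by
  refine ge_of_tendsto (SchauderBasis.tendsto_proj b x).norm ?_
  obtain ⟨N, hN⟩ := s.exists_nat_subset_range
  filter_upwards [eventually_ge_atTop N] with n hn
  rw [GeneralSchauderBasis.proj_apply, SchauderBasis.proj_apply]
  exact h.norm_sum_mono (hN.trans (Finset.range_mono hn)) fun k => b.coord k x

/-- A basis with a symmetric norm is unconditional: all coordinate projections are contractive. -/
theorem hasSum_expansion (h : IsSymmetricNorm b) (x : X) :
    HasSum (fun k => b.coord k x • b k) x := by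
  rw [HasSum, Metric.tendsto_nhds]
  intro ε hε
  obtain ⟨N, hN⟩ := ((Metric.tendsto_nhds.1 (SchauderBasis.tendsto_proj b x)) (ε / 2)
    (half_pos hε)).exists
  filter_upwards [eventually_ge_atTop (Finset.range N)] with s hs
  have h1 : GeneralSchauderBasis.proj b s (SchauderBasis.proj b N x)
      = SchauderBasis.proj b N x := by
    rw [SchauderBasis.proj, GeneralSchauderBasis.proj_comp]
    congr 2
    ext i
    simpa using fun hi => hs (Finset.mem_range.2 hi)
  rw [dist_eq_norm] at hN ⊢
  rw [← GeneralSchauderBasis.proj_apply]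
  have h2 : GeneralSchauderBasis.proj b s x - x
      = GeneralSchauderBasis.proj b s (x - SchauderBasis.proj b N x)
        + (SchauderBasis.proj b N x - x) := by
    rw [map_sub, h1]; abel
  rw [h2]
  calc _ ≤ _ := norm_add_le _ _
    _ ≤ ‖x - SchauderBasis.proj b N x‖ + ‖SchauderBasis.proj b N x - x‖ := by
        gcongr; exact h.norm_proj_apply_le _ _
    _ < ε := by rw [norm_sub_rev]; linarith

theorem summable_perm [CompleteSpace X] (h : IsSymmetricNorm b) (π : Equiv.Perm ℕ) (x : X) :
    Summable fun k => b.coord k x • b (π k) := by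
  rw [summable_iff_vanishing_norm]
  intro ε hε
  obtain ⟨s, hs⟩ := summable_iff_vanishing_norm.1 (h.hasSum_expansion x).summable ε hε
  exact ⟨s, fun t ht => by rw [h.norm_sum_perm π t fun k => b.coord k x]; exact hs t ht⟩

theorem norm_tsum_perm [CompleteSpace X] (h : IsSymmetricNorm b) (π : Equiv.Perm ℕ) (x : X) :
    ‖∑' k, b.coord k x • b (π k)‖ = ‖x‖ := by
  have h1 := Filter.Tendsto.norm (h.summable_perm π x).hasSum
  have h2 := Filter.Tendsto.norm (h.hasSum_expansion x)
  simp only [h.norm_sum_perm π _ fun k => b.coord k x] at h1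
  exact tendsto_nhds_unique h1 h2

/-- The isometry of `X` which sends `b k` to `b (π k)`. -/
def permIsometry [CompleteSpace X] (h : IsSymmetricNorm b) (π : Equiv.Perm ℕ) :
    X →ₗᵢ[ℂ] X where
  toFun x := ∑' k, b.coord k x • b (π k)
  map_add' x y := by
    simp only [map_add, add_smul]
    exact (h.summable_perm π x).tsum_add (h.summable_perm π y)
  map_smul' c x := by
    simp only [map_smul, smul_eq_mul, mul_smul, RingHom.id_apply]
    exact (h.summable_perm π x).tsum_const_smul c
  norm_map' := h.norm_tsum_perm π

theorem permIsometry_basis [CompleteSpace X] (h : IsSymmetricNorm b) (π : Equiv.Perm ℕ) (k : ℕ) :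
    h.permIsometry π (b k) = b (π k) := by
  change ∑' i, b.coord i (b k) • b (π i) = _
  rw [tsum_eq_single k fun i hi => by simp [coord_basis, hi]]
  simp [coord_basis]

theorem hasSum_permIsometry [CompleteSpace X] (h : IsSymmetricNorm b) (π : Equiv.Perm ℕ) (x : X) :
    HasSum (fun k => b.coord k x • b (π k)) (h.permIsometry π x) :=
  (h.summable_perm π x).hasSum

end IsSymmetricNorm

/-! ### Cyclic shifts of finitely many vectors -/

theorem pow_apply_cycle {S : X →L[ℂ] X} {e : ℕ → X} (he : ∀ j, S (e j) = e (j + 1)) (l j : ℕ) :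
    (S ^ l) (e j) = e (j + l) := by
  induction l with
  | zero => simp
  | succ l ih => rw [pow_succ', mul_apply_eq_comp, ih, he]; rfl

theorem norm_pow_apply {S : X →L[ℂ] X} (hS : ∀ x, ‖S x‖ = ‖x‖) (l : ℕ) (x : X) :
    ‖(S ^ l) x‖ = ‖x‖ := by
  induction l with
  | zero => simp
  | succ l ih => rw [pow_succ', mul_apply_eq_comp, hS, ih]

theorem pow_apply_sum_cycle {S : X →L[ℂ] X} {e : ℕ → X} (he : ∀ j, S (e j) = e (j + 1)) (m : ℕ) :
    (S ^ m) (∑ i ∈ Finset.range m, e i) = ∑ i ∈ Finset.Ico m (2 * m), e i := by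
  rw [map_sum, Finset.sum_Ico_eq_sum_range, show 2 * m - m = m by omega]
  exact Finset.sum_congr rfl fun i _ => by rw [pow_apply_cycle he, add_comm]

/-- Let `u = ∑_{i < m} e i` and `w = ∑_{l < 2m} S^l (u - S^m u)`. In `w + S^m w` the terms telescope
to `∑_{l < 2m} (S^l u - S^{l + 2m} u)`, whose part carried by `e m, …, e (2m - 1)` is `m S^m u`;
hence `m ‖u‖ ≤ 2 ‖w‖`. The bound `5 m` on the indices covers every `e j` that occurs, also when
the `e j` are periodic with a period `≥ 4 m`. -/
theorem mul_norm_sum_le_norm_sum_pow_apply {S Q : X →L[ℂ] X} {e : ℕ → X} {m : ℕ}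
    (hS : ∀ x, ‖S x‖ = ‖x‖) (hQ : ∀ x, ‖Q x‖ ≤ ‖x‖) (he : ∀ j, S (e j) = e (j + 1))
    (hQe : ∀ j < 5 * m, Q (e j) = if m ≤ j ∧ j < 2 * m then e j else 0) :
    m * ‖∑ i ∈ Finset.range m, e i‖ ≤ 2 * ‖∑ l ∈ Finset.range (2 * m),
      (S ^ l) (∑ i ∈ Finset.range m, e i - ∑ i ∈ Finset.Ico m (2 * m), e i)‖ := by
  set u := ∑ i ∈ Finset.range m, e i with hu
  have hSu : (S ^ m) u = ∑ i ∈ Finset.Ico m (2 * m), e i := pow_apply_sum_cycle he m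
  rw [← hSu]
  set w := ∑ l ∈ Finset.range (2 * m), (S ^ l) (u - (S ^ m) u) with hw
  have h1 : w + (S ^ m) w = ∑ l ∈ Finset.range (2 * m), ∑ i ∈ Finset.range m,
      (e (i + l) - e (i + l + 2 * m)) := by
    rw [hw, map_sum (S ^ m) fun l => (S ^ l) (u - (S ^ m) u), ← Finset.sum_add_distrib]
    refine Finset.sum_congr rfl fun l _ => ?_
    simp only [map_sub, hu, map_sum, pow_apply_cycle he, ← Finset.sum_sub_distrib,
      ← Finset.sum_add_distrib]
    refine Finset.sum_congr rfl fun i _ => ?_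
    rw [show i + m + l = i + l + m by ring, show i + l + m + m = i + l + 2 * m by ring]
    abel
  have h2 : Q (w + (S ^ m) w) = (m : ℂ) • (S ^ m) u := by
    rw [h1, Finset.sum_comm, map_sum, hSu, ← Finset.card_range m, Nat.cast_smul_eq_nsmul,
      ← Finset.sum_const, Finset.card_range]
    refine Finset.sum_congr rfl fun i hi => ?_
    rw [Finset.mem_range] at hi
    -- Every `e j` with `m ≤ j < 2 m` occurs exactly once in `∑_l e (i + l)`.
    have h3 : ∀ l ∈ Finset.range (2 * m), Q (e (i + l) - e (i + l + 2 * m))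
        = if m ≤ i + l ∧ i + l < 2 * m then e (i + l) else 0 := fun l hl => by
      rw [Finset.mem_range] at hl
      rw [map_sub, hQe _ (by omega), hQe (i + l + 2 * m) (by omega),
        if_neg (c := m ≤ i + l + 2 * m ∧ _) (by omega), sub_zero]
    rw [map_sum, Finset.sum_congr rfl h3, ← Finset.sum_filter]
    refine Finset.sum_bij (fun l _ => i + l) (fun l hl => ?_) (fun l _ l' _ h => ?_)
      (fun j hj => ⟨j - i, ?_, ?_⟩) (fun _ _ => rfl)
    · simp at hl ⊢; omega
    · simpa using h
    · simp at hj ⊢; omega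
    · simp at hj; omega
  calc (m : ℝ) * ‖u‖ = ‖Q (w + (S ^ m) w)‖ := by
        rw [h2, norm_smul, norm_pow_apply hS, Complex.norm_natCast]
    _ ≤ ‖w + (S ^ m) w‖ := hQ _
    _ ≤ ‖w‖ + ‖(S ^ m) w‖ := norm_add_le _ _
    _ = 2 * ‖w‖ := by rw [norm_pow_apply hS]; ring

/-- A cyclic shift of length `H` has every `H`-th root of unity as an eigenvalue, with the
corresponding Fourier vector as eigenvector. -/
theorem apply_eigenvector_cycle {S : X →L[ℂ] X} {e : ℕ → X} {H : ℕ}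
    (he : ∀ j, S (e j) = e (j + 1)) (heH : e H = e 0) {ω : ℂ} (hω : ω ^ H = 1) (hω0 : ω ≠ 0) :
    S (∑ j ∈ Finset.range H, (ω ^ j)⁻¹ • e j) = ω • ∑ j ∈ Finset.range H, (ω ^ j)⁻¹ • e j := by
  have h1 : ∑ j ∈ Finset.range H, (ω ^ j)⁻¹ • e j
      = ∑ j ∈ Finset.range H, (ω ^ (j + 1))⁻¹ • e (j + 1) := by
    have := Finset.sum_range_succ' (fun j => (ω ^ j)⁻¹ • e j) H
    rw [Finset.sum_range_succ, hω, heH, pow_zero] at this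
    exact add_right_cancel this
  conv_rhs => rw [h1]
  rw [map_sum, Finset.smul_sum]
  refine Finset.sum_congr rfl fun j _ => ?_
  rw [map_smul, he, smul_smul]
  congr 1
  rw [pow_succ]
  field_simp

theorem sphere_subset_of_rootsOfUnity {s : Set ℂ} (hs : IsClosed s) {H : ℕ → ℕ}
    (hH : Tendsto H atTop atTop) (h : ∀ k ω, 0 < H k → ω ^ H k = 1 → ω ∈ s) :
    Metric.sphere (0 : ℂ) 1 ⊆ s := by
  intro z hz
  have hz1 : ‖z‖ = 1 := by simpa using hz
  -- `t` is an argument of `z` measured in turns and shifted to be nonnegative, so that `⌊t H⌋₊ / H`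
  -- tends to `t`.
  set t : ℝ := (Complex.arg z + 2 * Real.pi) / (2 * Real.pi) with ht
  have hpi := Real.pi_pos
  have ht0 : 0 ≤ t := by
    have := Complex.neg_pi_lt_arg z
    exact div_nonneg (by linarith) (by linarith)
  have hzt : Complex.exp (2 * Real.pi * Complex.I * (t : ℂ)) = z := by
    have : 2 * Real.pi * Complex.I * (t : ℂ) = Complex.arg z * Complex.I
        + 2 * Real.pi * Complex.I := by
      have : (Real.pi : ℂ) ≠ 0 := by exact_mod_cast hpi.ne'
      rw [ht]; push_cast; field_simp
    rw [this, Complex.exp_periodic]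
    have := Complex.norm_mul_exp_arg_mul_I z
    rwa [hz1, Complex.ofReal_one, one_mul] at this
  have hlim : Tendsto (fun k => Complex.exp (2 * Real.pi * Complex.I *
      (((⌊t * (H k : ℝ)⌋₊ : ℝ) / (H k : ℝ) : ℝ) : ℂ))) atTop (𝓝 z) := by
    rw [← hzt]
    refine ((by fun_prop : Continuous fun r : ℝ =>
      Complex.exp (2 * Real.pi * Complex.I * (r : ℂ))).tendsto t).comp ?_
    exact (tendsto_nat_floor_mul_div_atTop ht0).comp
      (tendsto_natCast_atTop_atTop.comp hH)
  refine hs.mem_of_tendsto hlim ?_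
  filter_upwards [hH.eventually_gt_atTop 0] with k hk
  refine h k _ hk ?_
  have hk' : (H k : ℂ) ≠ 0 := by exact_mod_cast hk.ne'
  rw [← Complex.exp_nat_mul, Complex.exp_eq_one_iff]
  refine ⟨⌊t * (H k : ℝ)⌋₊, ?_⟩
  push_cast
  field_simp

/-! ### The block cycle operator -/

/-- The permutation of `ℕ` which fixes `0` and `1` and moves the remaining indices, grouped into
blocks by `φ`, along the cycle of their block. -/
def cyclePerm (a : ℕ → ℕ) (φ : (Σ k, Fin (hsH a k)) ≃ ℕ) : Equiv.Perm ℕ :=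
  let τ : Equiv.Perm ℕ := φ.permCongr (Equiv.sigmaCongrRight fun k => finRotate (hsH a k))
  { toFun := fun | 0 => 0 | 1 => 1 | n + 2 => τ n + 2
    invFun := fun | 0 => 0 | 1 => 1 | n + 2 => τ.symm n + 2
    left_inv := fun | 0 => rfl | 1 => rfl | n + 2 => by simp
    right_inv := fun | 0 => rfl | 1 => rfl | n + 2 => by simp }

theorem cyclePerm_block (a : ℕ → ℕ) (φ : (Σ k, Fin (hsH a k)) ≃ ℕ) (p : Σ k, Fin (hsH a k)) :
    cyclePerm a φ (φ p + 2) = φ ⟨p.1, finRotate _ p.2⟩ + 2 := by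
  change φ (Equiv.sigmaCongrRight (fun k => finRotate (hsH a k)) (φ.symm (φ p))) + 2 = _
  rw [Equiv.symm_apply_apply]
  rfl

variable {b : SchauderBasis ℂ X} {a : ℕ → ℕ} {φ : (Σ k, Fin (hsH a k)) ≃ ℕ}

theorem isCycleOperator_permIsometry [CompleteSpace X] (h : IsSymmetricNorm b) :
    IsCycleOperator b a φ (h.permIsometry (cyclePerm a φ)).toContinuousLinearMap := by
  intro x
  have h1 := (hasSum_nat_add_iff' 2).2 (h.hasSum_permIsometry (cyclePerm a φ) x)
  rw [Finset.sum_range_succ, Finset.sum_range_one] at h1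
  have h2 := (φ.hasSum_iff.2 h1).sigma fun k => hasSum_fintype _
  simpa only [Function.comp_def, cyclePerm_block] using! h2

theorem IsCycleOperator.eq_permIsometry [CompleteSpace X] (h : IsSymmetricNorm b)
    {S : X →L[ℂ] X} (hS : IsCycleOperator b a φ S) :
    S = (h.permIsometry (cyclePerm a φ)).toContinuousLinearMap := by
  ext x
  exact sub_left_injective ((hS x).unique (isCycleOperator_permIsometry h x))

theorem coord_permIsometry_of_fixed [CompleteSpace X] (h : IsSymmetricNorm b)
    {π : Equiv.Perm ℕ} {i : ℕ} (hi : π i = i) (x : X) :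
    b.coord i (h.permIsometry π x) = b.coord i x := by
  have : (b.coord i).comp (h.permIsometry π).toContinuousLinearMap = b.coord i :=
    b.ext_clm fun k => by
      have : i = π k ↔ i = k := ⟨fun e => π.injective (hi.trans e), fun e => e ▸ hi.symm⟩
      simp [h.permIsometry_basis, coord_basis, this]
  exact congrArg (fun g => g x) this

/-- The vectors of the block `k`, repeated periodically over all `j : ℕ`, so that the cycle acts on
them by `j ↦ j + 1`. -/
def orbitVec (b : SchauderBasis ℂ X) (a : ℕ → ℕ) (φ : (Σ k, Fin (hsH a k)) ≃ ℕ) (k : ℕ)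
    (hH : 0 < hsH a k) (j : ℕ) : X :=
  blockVec b a φ k ⟨j % hsH a k, Nat.mod_lt _ hH⟩

theorem permIsometry_orbitVec [CompleteSpace X] (h : IsSymmetricNorm b) {k : ℕ}
    (hH : 0 < hsH a k) (j : ℕ) :
    h.permIsometry (cyclePerm a φ) (orbitVec b a φ k hH j) = orbitVec b a φ k hH (j + 1) := by
  have hrot : finRotate (hsH a k) ⟨j % hsH a k, Nat.mod_lt _ hH⟩
      = ⟨(j + 1) % hsH a k, Nat.mod_lt _ hH⟩ := by
    have : NeZero (hsH a k) := ⟨hH.ne'⟩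
    rw [finRotate_apply]
    ext
    simp [Fin.val_add]
  unfold orbitVec blockVec
  rw [h.permIsometry_basis, cyclePerm_block]
  exact congrArg (fun i => b (φ ⟨k, i⟩ + 2)) hrot

theorem hsM_pos {a : ℕ → ℕ} (ha : ∀ k, 0 < a k) (k : ℕ) : 0 < hsM a k :=
  Finset.prod_pos fun i _ => ha i

theorem hsM_succ (a : ℕ → ℕ) (k : ℕ) : hsM a (k + 1) = hsM a k * a (k + 1) :=
  Finset.prod_range_succ _ _

theorem le_hsM {a : ℕ → ℕ} (ha : ∀ k, 0 < a k) (k : ℕ) : a k ≤ hsM a k :=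
  Finset.single_le_prod' (f := a) (fun i _ => ha i) (Finset.self_mem_range_succ k)

theorem four_mul_hsM_le {a : ℕ → ℕ} (ha : ∀ k, 0 < a k) (k : ℕ) : 4 * hsM a k ≤ hsH a k := by
  have := Nat.le_mul_of_pos_right (hsM a k) (ha (k + 1))
  rw [hsH, hsM_succ]; omega

theorem proj_orbitVec {k : ℕ} (hH : 0 < hsH a k) (j : ℕ) :
    proj b (orbitVec b a φ k hH j) = 0 := proj_basis b _

theorem bump_eq (hH : 0 < hsH a k) (h4 : 4 * hsM a k ≤ hsH a k) :
    bump b a φ k = ∑ i ∈ Finset.range (hsM a k), orbitVec b a φ k hH i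
      - ∑ i ∈ Finset.Ico (hsM a k) (2 * hsM a k), orbitVec b a φ k hH i := by
  have key : ∀ i : Fin (hsH a k), blockVec b a φ k i = orbitVec b a φ k hH i := fun i => by
    unfold orbitVec
    congr
    exact Fin.ext (Nat.mod_eq_of_lt i.2).symm
  simp only [bump, Finset.sum_filter, key]
  rw [Fin.sum_univ_eq_sum_range (fun j => if j < hsM a k then orbitVec b a φ k hH j else 0),
    Fin.sum_univ_eq_sum_range (fun j => if hsM a k ≤ j ∧ j < 2 * hsM a k then
      orbitVec b a φ k hH j else 0), ← Finset.sum_filter, ← Finset.sum_filter]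
  congr 2 <;> ext j <;> simp <;> omega

theorem blockIndex_eq_iff {k : ℕ} (hH : 0 < hsH a k) (i j : ℕ) :
    φ ⟨k, ⟨i % hsH a k, Nat.mod_lt _ hH⟩⟩ + 2 = φ ⟨k, ⟨j % hsH a k, Nat.mod_lt _ hH⟩⟩ + 2 ↔
      i % hsH a k = j % hsH a k := by
  simp

/-- The vector `∑_{l < 2 m_k} S^l (bump k)` does not vanish, so that `ε_k` exists, and is large
compared with the bump: normalizing it gives `‖v_k‖ ≤ 4 / a_k`. -/
theorem norm_sum_pow_bump [CompleteSpace X] (h : IsSymmetricNorm b)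
    (ha : ∀ k, 0 < a k) (k : ℕ) {S : X →L[ℂ] X} (hS : IsCycleOperator b a φ S) :
    0 < ‖∑ l ∈ Finset.range (2 * hsM a k), (S ^ l) (bump b a φ k)‖ ∧
    (a k : ℝ) * ‖bump b a φ k‖ ≤
      4 * ‖∑ l ∈ Finset.range (2 * hsM a k), (S ^ l) (bump b a φ k)‖ := by
  have h4 := four_mul_hsM_le ha k
  have hm := hsM_pos ha k
  have hH : 0 < hsH a k := by omega
  rw [hS.eq_permIsometry h]
  set U := (h.permIsometry (cyclePerm a φ)).toContinuousLinearMap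
  have hU : ∀ x, ‖U x‖ = ‖x‖ := (h.permIsometry (cyclePerm a φ)).norm_map
  have hUe : ∀ j, U (orbitVec b a φ k hH j) = orbitVec b a φ k hH (j + 1) :=
    permIsometry_orbitVec h hH
  set A : Finset ℕ := (Finset.Ico (hsM a k) (2 * hsM a k)).image
    fun j => φ ⟨k, ⟨j % hsH a k, Nat.mod_lt _ hH⟩⟩ + 2 with hA
  have hmem : ∀ j < 5 * hsM a k, φ ⟨k, ⟨j % hsH a k, Nat.mod_lt _ hH⟩⟩ + 2 ∈ A ↔
      hsM a k ≤ j ∧ j < 2 * hsM a k := fun j hj => by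
    simp only [hA, Finset.mem_image, Finset.mem_Ico, blockIndex_eq_iff hH]
    constructor
    · rintro ⟨i, hi, hij⟩
      rw [Nat.mod_eq_of_lt (by omega : i < hsH a k)] at hij
      -- As `5 m ≤ hsH a k + m`, an index `j ≥ hsH a k` wraps around to a remainder below `m`.
      rcases lt_or_ge j (hsH a k) with hjH | hjH
      · rw [Nat.mod_eq_of_lt hjH] at hij; omega
      · rw [Nat.mod_eq_sub_mod hjH, Nat.mod_eq_of_lt (by omega)] at hij; omega
    · exact fun hj => ⟨j, hj, rfl⟩
  have key := mul_norm_sum_le_norm_sum_pow_apply (Q := GeneralSchauderBasis.proj b A)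
    (m := hsM a k) hU (h.norm_proj_apply_le A) hUe fun j hj => by
      simp only [orbitVec, blockVec, GeneralSchauderBasis.proj_apply_basis_mem, hmem j hj]
  have hbump := bump_eq (b := b) (φ := φ) hH h4
  rw [← hbump] at key
  set u := ∑ i ∈ Finset.range (hsM a k), orbitVec b a φ k hH i with hu
  have hu1 : 0 < ‖u‖ := by
    rw [norm_pos_iff]
    intro hu0
    have h1 := congrArg (b.coord (φ ⟨k, ⟨0 % hsH a k, Nat.mod_lt _ hH⟩⟩ + 2)) hu0
    simp only [hu, map_sum, map_zero, orbitVec, blockVec, coord_basis, blockIndex_eq_iff hH] at h1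
    rw [Finset.sum_eq_single_of_mem 0 (Finset.mem_range.2 hm), if_pos rfl] at h1
    · exact one_ne_zero h1
    · intro j hj hj0
      rw [Finset.mem_range] at hj
      rw [if_neg]
      rw [Nat.zero_mod, Nat.mod_eq_of_lt (by omega)]; omega
  have hm' : (0 : ℝ) < hsM a k := by exact_mod_cast hm
  have hle : ‖bump b a φ k‖ ≤ 2 * ‖u‖ := by
    rw [hbump, ← pow_apply_sum_cycle hUe]
    refine (norm_sub_le _ _).trans ?_
    rw [norm_pow_apply hU, two_mul]
  -- The sharper factor `m_k` is available, but `a_k` is what the summability condition refers to.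
  have hak : (a k : ℝ) ≤ hsM a k := by exact_mod_cast le_hsM ha k
  refine ⟨by nlinarith [mul_pos hm' hu1], ?_⟩
  calc (a k : ℝ) * ‖bump b a φ k‖ ≤ hsM a k * (2 * ‖u‖) := by gcongr
    _ = 2 * (hsM a k * ‖u‖) := by ring
    _ ≤ _ := by linarith

theorem proj_bump (k : ℕ) : proj b (bump b a φ k) = 0 := by
  simp [bump, blockVec, proj_basis]

theorem exists_isHSOperator [CompleteSpace X] (h : IsSymmetricNorm b)
    {f : ℕ → StrongDual ℂ (plane b)} (ha : IsHSSequence f a) :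
    ∃ R : X →L[ℂ] X, IsHSOperator b f a φ R := by
  obtain ⟨S, hS⟩ : ∃ S : X →L[ℂ] X, IsCycleOperator b a φ S :=
    ⟨_, isCycleOperator_permIsometry h⟩
  set N : ℕ → ℝ := fun k => ‖∑ l ∈ Finset.range (2 * hsM a k), (S ^ l) (bump b a φ k)‖ with hN
  have hN0 : ∀ k, 0 < N k := fun k => (norm_sum_pow_bump h ha.pos k hS).1
  have hNb : ∀ k, (a k : ℝ) * ‖bump b a φ k‖ ≤ 4 * N k := fun k =>
    (norm_sum_pow_bump h ha.pos k hS).2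
  have hε : ∀ k, ‖(((N k)⁻¹ : ℝ) : ℂ)‖ = (N k)⁻¹ := fun k => by
    rw [Complex.norm_real, Real.norm_of_nonneg (inv_nonneg.2 (hN0 k).le)]
  obtain ⟨T, hT⟩ := exists_clm_hasSum_smul (proj b) f
    (fun k => (((N k)⁻¹ : ℝ) : ℂ) • bump b a φ k) (by
      refine Summable.of_nonneg_of_le (fun _ => by positivity) (fun k => ?_)
        (ha.summable.mul_left 4)
      have hak : (0 : ℝ) < a k := by exact_mod_cast ha.pos k
      rw [norm_smul, hε]
      have : (N k)⁻¹ * ‖bump b a φ k‖ ≤ 4 / a k := by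
        rw [inv_mul_eq_div, div_le_div_iff₀ (hN0 k) hak]
        linarith [hNb k]
      calc ‖f k‖ * ((N k)⁻¹ * ‖bump b a φ k‖) ≤ ‖f k‖ * (4 / a k) := by gcongr
        _ = _ := by ring)
  refine ⟨S + T, S, fun k => (N k)⁻¹, hS, fun k => ?_, fun x => by simpa using hT x⟩
  simp only [map_smul, ← Finset.smul_sum]
  rw [norm_smul, hε]
  exact inv_mul_cancel₀ (hN0 k).ne'

theorem tendsto_hsH {a : ℕ → ℕ} (hpos : ∀ k, 0 < a k) (ha : StrictMono a) :
    Tendsto (hsH a) atTop atTop :=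
  tendsto_atTop_mono (fun k => by
    have := le_hsM hpos k
    have := four_mul_hsM_le hpos k
    omega) ha.tendsto_atTop

theorem IsHSOperator.spectrum_bounds [CompleteSpace X] (h : IsSymmetricNorm b)
    {f : ℕ → StrongDual ℂ (plane b)} (ha : IsHSSequence f a) {R : X →L[ℂ] X}
    (hR : IsHSOperator b f a φ R) :
    Metric.sphere (0 : ℂ) 1 ⊆ spectrum ℂ R ∧ spectrum ℂ R ⊆ Metric.closedBall (0 : ℂ) 1 := by
  obtain ⟨S, ε, hS, -, hR⟩ := hR
  rw [hS.eq_permIsometry h] at hR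
  set U := (h.permIsometry (cyclePerm a φ)).toContinuousLinearMap
  constructor
  · refine sphere_subset_of_rootsOfUnity (spectrum.isClosed R) (tendsto_hsH ha.pos ha.strictMono)
      fun k ω hH hω => ?_
    have hω0 : ω ≠ 0 := by rintro rfl; simp [hH.ne'] at hω
    refine mem_spectrum_of_eigenvector
      (x := ∑ j ∈ Finset.range (hsH a k), (ω ^ j)⁻¹ • orbitVec b a φ k hH j) ?_ ?_
    · intro h0
      have h1 := congrArg (b.coord (φ ⟨k, ⟨0 % hsH a k, Nat.mod_lt _ hH⟩⟩ + 2)) h0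
      simp only [map_sum, map_smul, map_zero, orbitVec, blockVec, coord_basis,
        blockIndex_eq_iff hH] at h1
      rw [Finset.sum_eq_single_of_mem 0 (Finset.mem_range.2 hH), if_pos rfl] at h1
      · simp at h1
      · intro j hj hj0
        rw [Finset.mem_range] at hj
        rw [if_neg, smul_zero]
        rw [Nat.zero_mod, Nat.mod_eq_of_lt hj]; omega
    · rw [apply_eq_of_proj_eq_zero b hR (by simp [proj_orbitVec])]
      exact apply_eigenvector_cycle (permIsometry_orbitVec h hH) (by simp [orbitVec]) hω hω0
  · refine (spectrum_subset_of_hasSum_sub b (fun x => proj_congr b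
      (coord_permIsometry_of_fixed h rfl x) (coord_permIsometry_of_fixed h rfl x))
      (fun k => by rw [map_smul, proj_bump, smul_zero]) hR).trans
      ((spectrum.subset_closedBall_norm_mul U).trans (Metric.closedBall_subset_closedBall ?_))
    exact mul_le_one₀ (h.permIsometry (cyclePerm a φ)).norm_toContinuousLinearMap_le
      (norm_nonneg _) ContinuousLinearMap.norm_id_le

end OrbitSpectra

end

theorem proposition5p1 {X : Type*} [NormedAddCommGroup X] [NormedSpace ℂ X] [CompleteSpace X]
    (b : SchauderBasis ℂ X) (hb : ∀ k, ‖b k‖ = 1)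
    (F : Set (OrbitSpectra.plane b)) (hF : OrbitSpectra.IsClosedUnionOfLines F)
    (f : ℕ → StrongDual ℂ (OrbitSpectra.plane b)) (hf : OrbitSpectra.IsSeparating F f) :
    (∀ m : ℕ → ℕ, OrbitSpectra.IsFastSequence f m →
      (∃ R : X →L[ℂ] X, OrbitSpectra.IsDiagonalTypeOperator b f m R) ∧
      ∀ R : X →L[ℂ] X, OrbitSpectra.IsDiagonalTypeOperator b f m R →
        spectrum ℂ R = Set.range (OrbitSpectra.lam m)) ∧
    (OrbitSpectra.IsSymmetricBasis b → OrbitSpectra.IsSymmetricNorm b →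
      ∀ a : ℕ → ℕ, OrbitSpectra.IsHSSequence f a →
      ∀ φ : (Σ k, Fin (OrbitSpectra.hsH a k)) ≃ ℕ,
      (∃ R : X →L[ℂ] X, OrbitSpectra.IsHSOperator b f a φ R) ∧
      ∀ R : X →L[ℂ] X, OrbitSpectra.IsHSOperator b f a φ R →
        Metric.sphere (0 : ℂ) 1 ⊆ spectrum ℂ R ∧
        spectrum ℂ R ⊆ Metric.closedBall (0 : ℂ) 1) := by
  refine ⟨fun m hm => ⟨OrbitSpectra.exists_isDiagonalTypeOperator b hb hm,
    fun R hR => hR.spectrum_eq hb hm⟩, fun _ h a ha φ =>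
    ⟨OrbitSpectra.exists_isHSOperator h ha, fun R hR => hR.spectrum_bounds h ha⟩⟩
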